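/- Let $p$ be a prime, let $n,m\ge 1$ be integers, and let $G$ be a cyclic group of order $p^n$ with a fixed generator $\sigma$. Put $R_m=\mathbb{Z}/p^m\mathbb{Z}$, let $R_mG$ be the group ring, and for $i\ge 1$ let $U_i=1+p^i\mathbb{Z}$ and $-U_i=\{-u:u\in U_i\}$. By convention $p^{-\infty}=0$, and $\sigma^{p^{-\infty}}$ acts as $0$ on every $R_mG$-module. For $\mathbf{a}=(a_0,\dots,a_{m-1})\in\{-\infty,0,1,\dots,n\}^m$ and $d\in\mathbb{Z}$, let $X_{\mathbf{a},d,m}$ be the $R_mG$-module with generators $y,x_0,\dots,x_{m-1}$ and relations $$(\sigma-d)y=\sum_{i=0}^{m-1}p^ix_i,\qquad \sigma^{p^{a_i}}x_i=x_i\quad(0\le i<m).$$ Call $(\mathbf{a},d)$ admissible if the following conditions hold: (I) $d\in U_1$; (II) $d^{p^{a_i}}\in U_{i+1}$ for all $0\le i<m$; (III) $a_i+j<a_{i+j}$ for all $0\le i<m$ and $1\le j<m-i$ with $a_{i+j}\ne-\infty$, except if $p=2$, $d\notin U_2$, $i=0$ and $a_0=0$; in that exceptional case one requires instead (for $i=0$)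 that $a_j\ne 0$ for all $1\le j<m$; (IV) if $p=2$ and $n=1$, then $a_0=-\infty$; (V) if $p=2$, $m\ge 2$, $a_0=0$, and $d\in -U_v\setminus -U_{v+1}$ for some $v\ge 2$, then $a_i>i-(v-1)$ for all $v\le i<m$ with $a_i\ne-\infty$. Then, for admissible $(\mathbf{a},d)$, the vector $\mathbf{a}$ is determined by module-theoretic invariants of $X_{\mathbf{a},d,m}$: there is a function $\Phi$ on $R_mG$-modules, taking equal values on isomorphic modules, such that $\Phi(X_{\mathbf{a},d,m})=\mathbf{a}$ for every admissible $(\mathbf{a},d)$. In particular, if $(\mathbf{a},d)$ and $(\tilde{\mathbf{a}},\tilde d)$ are both admissible and $\mathbf{a}\ne\tilde{\mathbf{a}}$, then $X_{\mathbf{a},d,m}$ and $X_{\tilde{\mathbf{a}},\tilde d,m}$ are not isomorphic as $R_mG$-modules. -/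

import Mathlib

universe u

/-- `p ^ e` for `e ∈ {-∞} ∪ ℕ`, with the convention `p ^ (-∞) = 0`. -/
def expBot (p : ℕ) : WithBot ℕ → ℕ
  | ⊥ => 0
  | (k : ℕ) => p ^ k

/-- The set `U_i = 1 + p ^ i ℤ` of integers. -/
def unitsU (p i : ℕ) : Set ℤ := {d : ℤ | ∃ x : ℤ, d = 1 + (p : ℤ) ^ i * x}

/-- The group ring `R_m G`, where `R_m = ℤ / p ^ m ℤ`. -/
abbrev GroupRing (p m : ℕ) (G : Type*) [CommGroup G] : Type _ :=
  MonoidAlgebra (ZMod (p ^ m)) G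

/-- The element of `R_m G` through which `σ ^ (p ^ e)` acts on modules: the group element
`σ ^ (p ^ e)` for `e ∈ ℕ`, and `0` for `e = -∞`. -/
noncomputable def sigmaPow (p m : ℕ) {G : Type*} [CommGroup G] (σ : G) :
    WithBot ℕ → GroupRing p m G
  | ⊥ => 0
  | (k : ℕ) => MonoidAlgebra.of (ZMod (p ^ m)) G (σ ^ (p ^ k))

/-- The free `R_m G`-module on the `m + 1` symbols `y` (the index `none`) and
`x_0, …, x_{m-1}` (the indices `some i`). -/
abbrev FreeGens (p m : ℕ) (G : Type*) [CommGroup G] : Type _ :=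
  Option (Fin m) →₀ GroupRing p m G

/-- The generator `y` of the free module. -/
noncomputable def genY (p m : ℕ) (G : Type*) [CommGroup G] : FreeGens p m G :=
  Finsupp.single none 1

/-- The generator `x_i` of the free module. -/
noncomputable def genX (p m : ℕ) (G : Type*) [CommGroup G] (i : Fin m) : FreeGens p m G :=
  Finsupp.single (some i) 1

/-- The submodule of relations, generated by `(σ - d) y - ∑ i, p ^ i x_i` and by the
`σ ^ (p ^ (a i)) x_i - x_i` for `0 ≤ i < m`. -/
noncomputable def relationsX (p m : ℕ) {G : Type*} [CommGroup G] (σ : G)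
    (a : Fin m → WithBot ℕ) (d : ℤ) : Submodule (GroupRing p m G) (FreeGens p m G) :=
  Submodule.span (GroupRing p m G)
    (insert
      ((MonoidAlgebra.of (ZMod (p ^ m)) G σ - (d : GroupRing p m G)) • genY p m G
        - ∑ i : Fin m, ((p : GroupRing p m G) ^ (i : ℕ)) • genX p m G i)
      (Set.range fun i : Fin m => sigmaPow p m σ (a i) • genX p m G i - genX p m G i))

/-- The `R_m G`-module `X_{a,d,m}` with generators `y, x_0, …, x_{m-1}` and relations
`(σ - d) y = ∑ i, p ^ i x_i` and `σ ^ (p ^ (a i)) x_i = x_i` for `0 ≤ i < m`. -/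
abbrev ModuleX (p m : ℕ) {G : Type*} [CommGroup G] (σ : G)
    (a : Fin m → WithBot ℕ) (d : ℤ) : Type _ :=
  FreeGens p m G ⧸ relationsX p m σ a d

/-- The exceptional situation `p = 2`, `d ∉ U_2`, `i = 0` and `a i = 0`. -/
def IsExceptional (p : ℕ) {m : ℕ} (a : Fin m → WithBot ℕ) (d : ℤ) (i : Fin m) : Prop :=
  p = 2 ∧ d ∉ unitsU p 2 ∧ (i : ℕ) = 0 ∧ a i = 0

/-- The hypotheses on a vector `a ∈ {-∞, 0, …, n} ^ m` and an integer `d`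
(`-∞` is `⊥ : WithBot ℕ`). -/
structure Admissible (p n m : ℕ) (a : Fin m → WithBot ℕ) (d : ℤ) : Prop where
  /-- `a` has entries in `{-∞, 0, …, n}`. -/
  range : ∀ i, a i ≤ (n : WithBot ℕ)
  /-- `d ∈ U_1`. -/
  mem_one : d ∈ unitsU p 1
  /-- `d ^ (p ^ (a i)) ∈ U_{i+1}`. -/
  pow_mem : ∀ i : Fin m, d ^ expBot p (a i) ∈ unitsU p ((i : ℕ) + 1)
  /-- `a_i + j < a_{i+j}` whenever `1 ≤ j < m - i` and `a_{i+j} ≠ -∞`, outside the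
  exceptional situation. -/
  add_lt : ∀ i k : Fin m, ∀ j : ℕ, 1 ≤ j → (k : ℕ) = (i : ℕ) + j → a k ≠ ⊥ →
    ¬ IsExceptional p a d i → a i + (j : WithBot ℕ) < a k
  /-- In the exceptional situation, `a_j ≠ 0` for `1 ≤ j < m`. -/
  ne_zero : ∀ i : Fin m, IsExceptional p a d i → ∀ j : Fin m, 1 ≤ (j : ℕ) → a j ≠ 0
  /-- If `p = 2` and `n = 1`, then `a_0 = -∞`. -/
  zero_bot : p = 2 → n = 1 → ∀ i : Fin m, (i : ℕ) = 0 → a i = ⊥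
  /-- If `p = 2`, `m ≥ 2`, `a_0 = 0` and `d ∈ -U_v ∖ -U_{v+1}` with `v ≥ 2`, then
  `a_i > i - (v - 1)` for all `v ≤ i < m` with `a_i ≠ -∞`. -/
  lt_of_neg : p = 2 → 2 ≤ m → (∀ i : Fin m, (i : ℕ) = 0 → a i = 0) →
    ∀ v : ℕ, 2 ≤ v → -d ∈ unitsU p v → -d ∉ unitsU p (v + 1) →
    ∀ i : Fin m, v ≤ (i : ℕ) → a i ≠ ⊥ → (((i : ℕ) - (v - 1) : ℕ) : WithBot ℕ) < a i

/-! The invariants that determine `a` are the numbers, for 0 ≤ j ≤ n, of homomorphisms from X to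
R_mG with values in the elements fixed by σ^(p^j). Read as sequences of coefficients, these elements
have period p^j and σ acts as the shift. A homomorphism is then an initial value y(0) with sequences
x_i of period p^min(a_i, j) (zero if a_i = -∞) such that the solution of y(t+1) = d y(t) + Σ p^i
x_i(t) returns to y(0) after p^j steps. These data form the kernel of an additive map `holonomy` to
ℤ/p^m. If its image has order p^(m - f_j), the count is p^(m S_j + f_j) with S_j = Σ p^min(a_i, j)
(`card_invariantHom_moduleX`, `Admissible.exists_isCorank`).

Admissibility enters through f_(a_i) = i for finite a_i: an impulse in x_i puts p^i in the image,
and conditions (I), (II), (III), (V) make the whole image divisible by p^i. Since 0 ≤ f_j ≤ m, the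
exponent gives S_j and f_j up to confusing f_j = 0 with f_j = m, which `Admissible.truncSum_le`
rules out. The S_j give the finite entries, and f_(a_i) = i gives their positions
(`Admissible.eq_of_isCorank`). -/

/-! ### Truncated power sums and counts of entries -/

@[simp] lemma expBot_bot (p : ℕ) : expBot p ⊥ = 0 := rfl

@[simp] lemma expBot_coe (p k : ℕ) : expBot p (k : WithBot ℕ) = p ^ k := rfl

lemma expBot_min_coe (p x k : ℕ) :
    expBot p (min (WithBot.some x) (k : WithBot ℕ)) = p ^ min x k := by
  have : min (WithBot.some x) (k : WithBot ℕ) = ((min x k : ℕ) : WithBot ℕ) :=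
    (WithBot.coe_min x k).symm
  rw [this, expBot_coe]

lemma expBot_mono {p : ℕ} (hp : 0 < p) {x y : WithBot ℕ} (h : x ≤ y) :
    expBot p x ≤ expBot p y := by
  induction x using WithBot.recBotCoe with
  | bot => simp
  | coe x =>
    induction y using WithBot.recBotCoe with
    | bot => simp at h
    | coe y => exact Nat.pow_le_pow_right hp (by exact_mod_cast h)

/-- The sum of the truncated powers `p ^ min (a i) j`. -/
def truncSum (p : ℕ) {m : ℕ} (a : Fin m → WithBot ℕ) (j : ℕ) : ℕ :=
  ∑ i, expBot p (min (a i) (j : WithBot ℕ))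

lemma truncSum_mono {p : ℕ} (hp : 0 < p) {m : ℕ} (a : Fin m → WithBot ℕ) {j k : ℕ} (h : j ≤ k) :
    truncSum p a j ≤ truncSum p a k :=
  Finset.sum_le_sum fun _ _ => expBot_mono hp (min_le_min_left _ (by exact_mod_cast h))

lemma truncSum_eq_of_forall_le {p m : ℕ} {a : Fin m → WithBot ℕ} {j k : ℕ}
    (h : ∀ i, a i ≤ (j : WithBot ℕ)) (hjk : j ≤ k) : truncSum p a k = truncSum p a j := by
  refine Finset.sum_congr rfl fun i _ => ?_
  rw [min_eq_left (h i), min_eq_left ((h i).trans (by exact_mod_cast hjk))]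

lemma truncSum_lt_succ {p : ℕ} (hp : 1 < p) {m : ℕ} {a : Fin m → WithBot ℕ} {j : ℕ} {i : Fin m}
    (h : ((j + 1 : ℕ) : WithBot ℕ) ≤ a i) : truncSum p a j < truncSum p a (j + 1) := by
  refine Finset.sum_lt_sum
    (fun _ _ => expBot_mono hp.le (min_le_min_left _ (by exact_mod_cast j.le_succ)))
    ⟨i, Finset.mem_univ i, ?_⟩
  have h' : ((j : ℕ) : WithBot ℕ) ≤ a i := le_trans (by exact_mod_cast j.le_succ) h
  rw [min_eq_right h, min_eq_right h', expBot_coe, expBot_coe]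
  exact Nat.pow_lt_pow_right hp j.lt_succ_self

/-- The number of entries of `a` that are at least `j`. -/
def countGe {m : ℕ} (a : Fin m → WithBot ℕ) (j : ℕ) : ℕ :=
  (Finset.univ.filter fun i => (j : WithBot ℕ) ≤ a i).card

lemma truncSum_zero (p : ℕ) {m : ℕ} (a : Fin m → WithBot ℕ) : truncSum p a 0 = countGe a 0 := by
  rw [truncSum, countGe, Finset.card_filter]
  refine Finset.sum_congr rfl fun i _ => ?_
  induction a i using WithBot.recBotCoe with
  | bot => simp
  | coe x =>
    have hx : ((0 : ℕ) : WithBot ℕ) ≤ WithBot.some x := WithBot.coe_le_coe.mpr x.zero_le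
    rw [min_eq_right hx, if_pos hx, expBot_coe, pow_zero]

lemma truncSum_succ {p : ℕ} (hp : 0 < p) {m : ℕ} (a : Fin m → WithBot ℕ) (j : ℕ) :
    truncSum p a (j + 1) = truncSum p a j + (p ^ (j + 1) - p ^ j) * countGe a (j + 1) := by
  rw [truncSum, truncSum, countGe, Finset.card_filter, Finset.mul_sum, ← Finset.sum_add_distrib]
  refine Finset.sum_congr rfl fun i _ => ?_
  induction a i using WithBot.recBotCoe with
  | bot => simp
  | coe x =>
    have hpow : p ^ j ≤ p ^ (j + 1) := Nat.pow_le_pow_right hp j.le_succ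
    rcases Nat.lt_or_ge x (j + 1) with h | h
    · have hx : ¬ ((j + 1 : ℕ) : WithBot ℕ) ≤ WithBot.some x := fun h' =>
        h.not_ge (WithBot.coe_le_coe.mp h')
      rw [if_neg hx, expBot_min_coe, expBot_min_coe, min_eq_left h.le,
        min_eq_left (Nat.lt_succ_iff.mp h), mul_zero, add_zero]
    · have hx : ((j + 1 : ℕ) : WithBot ℕ) ≤ WithBot.some x := WithBot.coe_le_coe.mpr h
      rw [if_pos hx, expBot_min_coe, expBot_min_coe, min_eq_right h,
        min_eq_right ((Nat.le_succ j).trans h)]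
      omega

lemma countGe_eq_of_truncSum_eq {p n m : ℕ} (hp : 1 < p) {a a' : Fin m → WithBot ℕ}
    (h : ∀ j ≤ n, truncSum p a j = truncSum p a' j) {j : ℕ} (hj : j ≤ n) :
    countGe a j = countGe a' j := by
  cases j with
  | zero => rw [← truncSum_zero p, ← truncSum_zero p, h 0 hj]
  | succ j =>
    have h1 := h (j + 1) hj
    rw [truncSum_succ (by omega), truncSum_succ (by omega), h j (by omega)] at h1
    have h2 : 0 < p ^ (j + 1) - p ^ j := Nat.sub_pos_of_lt (Nat.pow_lt_pow_right hp j.lt_succ_self)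
    exact Nat.eq_of_mul_eq_mul_left h2 (Nat.add_left_cancel h1)

/-- The number of entries equal to k is the drop of `countGe` from k to k + 1; for k = n the second
count vanishes by the range bound. -/
lemma exists_eq_of_countGe_eq {n m : ℕ} {a a' : Fin m → WithBot ℕ}
    (ha : ∀ i, a i ≤ (n : WithBot ℕ)) (ha' : ∀ i, a' i ≤ (n : WithBot ℕ))
    (h : ∀ j ≤ n, countGe a j = countGe a' j) {i : Fin m} {k : ℕ} (hk : a i = k) :
    ∃ i', a' i' = k := by
  have hkn : k ≤ n := by have := ha i; rw [hk] at this; exact_mod_cast this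
  have hzero : ∀ b : Fin m → WithBot ℕ, (∀ i, b i ≤ (n : WithBot ℕ)) → countGe b (n + 1) = 0 := by
    intro b hb
    rw [countGe, Finset.card_eq_zero, Finset.filter_eq_empty_iff]
    intro i _ hi
    have := hi.trans (hb i)
    norm_cast at this
    omega
  have h1 : countGe a (k + 1) = countGe a' (k + 1) := by
    rcases hkn.lt_or_eq with hlt | rfl
    · exact h _ hlt
    · rw [hzero a ha, hzero a' ha']
  have hsub : ∀ b : Fin m → WithBot ℕ, (Finset.univ.filter fun i => ((k + 1 : ℕ) : WithBot ℕ) ≤ b i) ⊆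
      Finset.univ.filter fun i => (k : WithBot ℕ) ≤ b i := by
    intro b i hi
    simp only [Finset.mem_filter, Finset.mem_univ, true_and] at hi ⊢
    exact le_trans (by exact_mod_cast k.le_succ) hi
  have h2 : countGe a (k + 1) < countGe a k := by
    refine Finset.card_lt_card ((Finset.ssubset_iff_of_subset (hsub a)).mpr ⟨i, ?_, ?_⟩)
    · simp only [Finset.mem_filter, Finset.mem_univ, true_and, hk]
      exact le_rfl
    · simp only [Finset.mem_filter, Finset.mem_univ, true_and, hk]
      norm_cast
      omega
  rw [h1, h k hkn] at h2
  obtain ⟨i', hi', hi''⟩ := Finset.exists_mem_notMem_of_card_lt_card h2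
  simp only [Finset.mem_filter, Finset.mem_univ, true_and] at hi' hi''
  refine ⟨i', ?_⟩
  generalize a' i' = x at hi' hi''
  induction x using WithBot.recBotCoe with
  | bot => simp at hi'
  | coe x =>
    have h3 : k ≤ x := WithBot.coe_le_coe.mp hi'
    have h4 : ¬ k + 1 ≤ x := fun h => hi'' (WithBot.coe_le_coe.mpr h)
    exact congrArg WithBot.some (show x = k by omega)

/-! ### Recovering `a` from the exponents m S_j + f_j -/

/-- The properties of the exponents `f j` in `# Hom = p ^ (m * truncSum p a j + f j)` which,
together with these cardinalities, determine `a`. -/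
structure IsCorank (n : ℕ) {m : ℕ} (a : Fin m → WithBot ℕ) (f : ℕ → ℕ) : Prop where
  le : ∀ j ≤ n, f j ≤ m
  pos : ∀ j ≤ n, (∀ i : Fin m, (i : ℕ) = 0 → a i < j) → 1 ≤ f j
  le_of_le : ∀ j ≤ n, ∀ i : Fin m, (j : WithBot ℕ) ≤ a i → f j ≤ i
  le_apply : ∀ (i : Fin m) (k : ℕ), a i = k → i ≤ f k

/-- A further finite entry would exceed n by condition (III); the exceptional case needs a_0 = 0,
whereas here a_0 = n ≥ 1. -/
lemma Admissible.eq_bot_of_eq_top {p n m : ℕ} (hn : 1 ≤ n) {a : Fin m → WithBot ℕ} {d : ℤ}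
    (h : Admissible p n m a d) {z : Fin m} (hz : (z : ℕ) = 0) (haz : a z = n) {i : Fin m}
    (hi : i ≠ z) : a i = ⊥ := by
  by_contra hne
  have hi0 : 1 ≤ (i : ℕ) := by
    have : (i : ℕ) ≠ z := fun e => hi (Fin.ext e)
    omega
  have hlt := h.add_lt z i i hi0 (by omega) hne fun hex => by
    have h0 := hex.2.2.2
    rw [haz] at h0
    norm_cast at h0
    omega
  have hle := hlt.trans_le (h.range i)
  rw [haz] at hle
  norm_cast at hle
  omega

/-- If S_j > S'_j, the bounds on f leave only S_j = S'_j + 1, f_j = 0, f'_j = m. Then a_0 ≥ j and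
all a'_i < j. For j < n, S' stays constant from j to j + 1 and the exponents at j + 1 cannot agree.
For j = n, comparing levels n and n - 1 leaves only p = 2, n = 1, which condition (IV) excludes. -/
lemma Admissible.truncSum_le {p n m : ℕ} (hp : p.Prime) (hn : 1 ≤ n) (hm : 1 ≤ m)
    {a a' : Fin m → WithBot ℕ} {d : ℤ} (h : Admissible p n m a d)
    {f f' : ℕ → ℕ} (hf : IsCorank n a f) (hf' : IsCorank n a' f')
    (heq : ∀ j ≤ n, m * truncSum p a j + f j = m * truncSum p a' j + f' j) {j : ℕ} (hj : j ≤ n) :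
    truncSum p a j ≤ truncSum p a' j := by
  by_contra! hlt
  have hmul : m * truncSum p a' j + m ≤ m * truncSum p a j := by
    rw [← Nat.mul_succ]; exact Nat.mul_le_mul_left m hlt
  have hej := heq j hj
  have hle := hf'.le j hj
  have hfj : f j = 0 := by omega
  have hfj' : f' j = m := by omega
  have ha' : ∀ i, a' i < j := by
    intro i
    by_contra! hi
    have := hf'.le_of_le j hj i hi
    omega
  set z : Fin m := ⟨0, hm⟩ with hz
  have haz : (j : WithBot ℕ) ≤ a z := by
    by_contra! hlt
    have := hf.pos j hj fun i hi => by rwa [show i = z from Fin.ext hi]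
    omega
  rcases hj.lt_or_eq with hjn | rfl
  · have h1 := heq (j + 1) hjn
    rw [truncSum_eq_of_forall_le (fun i => (ha' i).le) j.le_succ] at h1
    have h2 := hf'.le (j + 1) hjn
    -- From j to j + 1 either f rises from 0 or S increases; the primed exponent is at most m S'_j +
    -- m = m S_j, so both are impossible.
    rcases lt_or_ge (a z) ((j + 1 : ℕ) : WithBot ℕ) with h3 | h3
    · have h4 := hf.pos (j + 1) hjn fun i hi => by rwa [show i = z from Fin.ext hi]
      have h5 := Nat.mul_le_mul_left m (truncSum_mono hp.pos a j.le_succ)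
      simp only [Nat.succ_eq_add_one] at h5
      omega
    · have h5 := Nat.mul_le_mul_left m (truncSum_lt_succ hp.one_lt h3)
      simp only [Nat.succ_eq_add_one, Nat.mul_add_one] at h5
      omega
  · have hazn : a z = j := le_antisymm (h.range z) haz
    have hS : ∀ k ≤ j, truncSum p a k = p ^ k := by
      intro k hk
      rw [truncSum, Finset.sum_eq_single z]
      · rw [hazn, min_eq_right (by exact_mod_cast hk), expBot_coe]
      · intro i _ hi
        rw [h.eq_bot_of_eq_top hn rfl hazn hi, min_eq_left bot_le, expBot_bot]
      · simp
    obtain ⟨k, rfl⟩ : ∃ k, j = k + 1 := ⟨j - 1, by omega⟩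
    have h1 := heq k (by omega)
    have h2 : truncSum p a' (k + 1) = truncSum p a' k := by
      refine truncSum_eq_of_forall_le (fun i => ?_) k.le_succ
      have := ha' i
      generalize a' i = x at this
      induction x using WithBot.recBotCoe with
      | bot => exact bot_le
      | coe x => exact WithBot.coe_le_coe.mpr (Nat.lt_succ_iff.mp (WithBot.coe_lt_coe.mp this))
    have h3 := hf.le_of_le k (by omega) z (by rw [hazn]; exact_mod_cast k.le_succ)
    rw [hS _ le_rfl, h2] at hej
    rw [hS _ k.le_succ] at h1
    have h4 : f k = 0 := by simpa [hz] using h3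
    -- Level k + 1 gives S'_k + 1 = p^(k+1) and level k gives S'_k ≤ p^k, so p^(k+1) ≤ p^k + 1.
    have h5 : m * (truncSum p a' k + 1) = m * p ^ (k + 1) := by rw [Nat.mul_add_one]; omega
    have h6 := Nat.eq_of_mul_eq_mul_left hm h5
    have h7 : truncSum p a' k ≤ p ^ k := Nat.le_of_mul_le_mul_left (by omega) hm
    rw [pow_succ] at h6
    have hpk : 1 ≤ p ^ k := Nat.one_le_pow _ _ hp.pos
    have hp2 : p = 2 := by
      by_contra hne
      have : 3 ≤ p := by have := hp.two_le; omega
      nlinarith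
    subst hp2
    have hk0 : k = 0 := by
      by_contra hne
      have := Nat.one_lt_two_pow hne
      omega
    subst hk0
    have := h.zero_bot rfl rfl z rfl
    rw [hazn] at this
    simp at this

/-- Once S and f agree, both vectors have the same finite values, and `le_of_le` with `le_apply`
forces f k = i whenever a_i = k, so a value fixes its position. -/
theorem Admissible.eq_of_isCorank {p n m : ℕ} (hp : p.Prime) (hn : 1 ≤ n) (hm : 1 ≤ m)
    {a a' : Fin m → WithBot ℕ} {d d' : ℤ} (h : Admissible p n m a d)
    (h' : Admissible p n m a' d') {f f' : ℕ → ℕ} (hf : IsCorank n a f) (hf' : IsCorank n a' f')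
    (heq : ∀ j ≤ n, m * truncSum p a j + f j = m * truncSum p a' j + f' j) : a = a' := by
  have hS : ∀ j ≤ n, truncSum p a j = truncSum p a' j := fun j hj =>
    le_antisymm (h.truncSum_le hp hn hm hf hf' heq hj)
      (h'.truncSum_le hp hn hm hf' hf (fun j hj => (heq j hj).symm) hj)
  have hff : ∀ j ≤ n, f j = f' j := fun j hj => by
    have := heq j hj
    rw [hS j hj] at this
    omega
  have key : ∀ {b b' : Fin m → WithBot ℕ} {g g' : ℕ → ℕ}, (∀ i, b i ≤ (n : WithBot ℕ)) →
      (∀ i, b' i ≤ (n : WithBot ℕ)) → IsCorank n b g → IsCorank n b' g' →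
      (∀ j ≤ n, g j = g' j) → (∀ j ≤ n, countGe b j = countGe b' j) →
      ∀ (i : Fin m) (k : ℕ), b i = k → b' i = k := by
    intro b b' g g' hb hb' hg hg' hgg hc i k hk
    obtain ⟨i', hi'⟩ := exists_eq_of_countGe_eq hb hb' hc hk
    have hkn : k ≤ n := by have := hb i; rw [hk] at this; exact_mod_cast this
    have h1 := hg.le_apply i k hk
    have h2 := hg.le_of_le k hkn i hk.ge
    have h3 := hg'.le_apply i' k hi'
    have h4 := hg'.le_of_le k hkn i' hi'.ge
    have h5 := hgg k hkn
    rwa [show i = i' from Fin.ext (by omega)]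
  have hc : ∀ j ≤ n, countGe a j = countGe a' j := fun j hj =>
    countGe_eq_of_truncSum_eq hp.one_lt hS hj
  funext i
  cases hi : a i using WithBot.recBotCoe with
  | coe k => exact (key h.range h'.range hf hf' hff hc i k hi).symm
  | bot =>
    cases hi' : a' i using WithBot.recBotCoe with
    | bot => rfl
    | coe k =>
      have := key h'.range h.range hf' hf (fun j hj => (hff j hj).symm)
        (fun j hj => (hc j hj).symm) i k hi'
      rw [hi] at this
      simp at this

/-! ### Affine recursions with periodic inhomogeneity -/

section AffineRecursion

variable {R : Type*} [CommRing R]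

/-- The solution of the recursion `y (t + 1) = d * y t + w t` with initial value `y₀`. -/
def affineIter (d : R) (w : ℕ → R) (y₀ : R) : ℕ → R
  | 0 => y₀
  | t + 1 => d * affineIter d w y₀ t + w t

lemma affineIter_eq_pow_mul_add (d : R) (w : ℕ → R) (y₀ : R) (t : ℕ) :
    affineIter d w y₀ t = d ^ t * y₀ + affineIter d w 0 t := by
  induction t with
  | zero => simp [affineIter]
  | succ t ih => simp only [affineIter, ih]; ring

lemma affineIter_add (d : R) (w w' : ℕ → R) (y y' : R) (t : ℕ) :
    affineIter d (w + w') (y + y') t = affineIter d w y t + affineIter d w' y' t := by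
  induction t with
  | zero => simp [affineIter]
  | succ t ih => simp only [affineIter, ih, Pi.add_apply]; ring

lemma affineIter_sum_mul {ι : Type*} (s : Finset ι) (c : ι → R) (x : ι → ℕ → R) (d : R) (t : ℕ) :
    affineIter d (fun t => ∑ i ∈ s, c i * x i t) 0 t = ∑ i ∈ s, c i * affineIter d (x i) 0 t := by
  induction t with
  | zero => simp [affineIter]
  | succ t ih =>
    simp only [affineIter, ih, Finset.mul_sum, ← Finset.sum_add_distrib]
    exact Finset.sum_congr rfl fun _ _ => by ring

lemma affineIter_zero (d : R) (t : ℕ) : affineIter d (fun _ => 0) 0 t = 0 := by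
  induction t with
  | zero => rfl
  | succ t ih => simp [affineIter, ih]

lemma affineIter_add_right (d : R) (w : ℕ → R) (y : R) (u v : ℕ) :
    affineIter d w y (u + v) = affineIter d (fun t => w (t + u)) (affineIter d w y u) v := by
  induction v with
  | zero => rfl
  | succ v ih => rw [← add_assoc, affineIter, affineIter, ih, add_comm v u]

/-- Each block of e steps applies the same affine map y ↦ d^e y + c; its b-th iterate at 0 is c
times a geometric sum. -/
lemma affineIter_mul_of_periodic (d : R) {w : ℕ → R} {e : ℕ} (hw : Function.Periodic w e) (b : ℕ) :
    affineIter d w 0 (e * b) = (∑ s ∈ Finset.range b, (d ^ e) ^ s) * affineIter d w 0 e := by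
  induction b with
  | zero => simp [affineIter]
  | succ b ih =>
    have hw' : (fun t => w (t + e * b)) = w := funext fun t => by
      rw [mul_comm]; exact_mod_cast hw.nat_mul b t
    rw [Nat.mul_succ, affineIter_add_right, hw', affineIter_eq_pow_mul_add, ih, geom_sum_succ]
    ring

lemma affineIter_periodic {d : R} {w : ℕ → R} {y : R} {e : ℕ} (hw : Function.Periodic w e)
    (hy : affineIter d w y e = y) : Function.Periodic (affineIter d w y) e := by
  intro t
  rw [add_comm, affineIter_add_right, hy]
  congr 1
  exact funext hw

lemma eq_affineIter {d : R} {w y : ℕ → R} (h : ∀ t, y (t + 1) = d * y t + w t) (t : ℕ) :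
    y t = affineIter d w (y 0) t := by
  induction t with
  | zero => rfl
  | succ t ih => rw [h, ih]; rfl

/-- The sequence of period `e` with given initial segment, and the zero sequence for `e = 0`. -/
def periodicExt {e : ℕ} (z : Fin e → R) (t : ℕ) : R :=
  if h : 0 < e then z ⟨t % e, Nat.mod_lt t h⟩ else 0

lemma periodicExt_periodic {e : ℕ} (z : Fin e → R) : Function.Periodic (periodicExt z) e := by
  intro t
  simp [periodicExt]

lemma periodicExt_add {e : ℕ} (z z' : Fin e → R) :
    periodicExt (z + z') = periodicExt z + periodicExt z' := by
  funext t
  by_cases h : 0 < e <;> simp [periodicExt, h]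

lemma periodicExt_apply_fin {e : ℕ} (z : Fin e → R) (t : Fin e) : periodicExt z t = z t := by
  have h : 0 < e := t.pos
  simp [periodicExt, h, Nat.mod_eq_of_lt t.isLt]

lemma periodicExt_eq {e : ℕ} (he : 0 < e) {s : ℕ → R} (hs : Function.Periodic s e) :
    periodicExt (fun t : Fin e => s t) = s := by
  funext t
  simp [periodicExt, he, hs.map_mod_nat]

/-- An impulse at the last step is not multiplied by d afterwards. -/
lemma affineIter_periodicExt_single (d : R) {e : ℕ} (he : 0 < e) :
    affineIter d (periodicExt (Pi.single ⟨e - 1, by omega⟩ 1 : Fin e → R)) 0 e = 1 := by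
  obtain ⟨k, rfl⟩ : ∃ k, e = k + 1 := ⟨e - 1, by omega⟩
  set w : ℕ → R := periodicExt (Pi.single ⟨k + 1 - 1, by omega⟩ 1 : Fin (k + 1) → R) with hw
  have hval : ∀ t, t ≤ k → w t = if t = k then 1 else 0 := by
    intro t ht
    have := periodicExt_apply_fin (Pi.single ⟨k + 1 - 1, by omega⟩ 1 : Fin (k + 1) → R)
      ⟨t, by omega⟩
    rw [hw, this, Pi.single_apply]
    simp [Fin.ext_iff]
  have hzero : ∀ t, t ≤ k → affineIter d w 0 t = 0 := by
    intro t
    induction t with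
    | zero => intro _; rfl
    | succ t ih =>
      intro ht
      rw [affineIter, ih (by omega), hval t (by omega), if_neg (by omega)]
      simp
  rw [affineIter, hzero k le_rfl, hval k le_rfl]
  simp

end AffineRecursion

/-! ### Divisibility of geometric sums -/

section Arithmetic

lemma dvd_pow_sub_one {q e : ℤ} (h : q ∣ e - 1) (k : ℕ) : q ∣ e ^ k - 1 :=
  h.trans (by simpa using sub_dvd_pow_sub_pow e 1 k)

lemma geom_sum_mul_index (e : ℤ) (a b : ℕ) :
    ∑ t ∈ Finset.range (a * b), e ^ t =
      (∑ s ∈ Finset.range b, (e ^ a) ^ s) * ∑ t ∈ Finset.range a, e ^ t := by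
  -- Geometric sums are the orbit of 0 under y ↦ e y + 1.
  have hgeom : ∀ b, affineIter e (fun _ => (1 : ℤ)) 0 b = ∑ t ∈ Finset.range b, e ^ t := by
    intro b
    induction b with
    | zero => rfl
    | succ b ihb => rw [affineIter, ihb, geom_sum_succ]
  simpa only [hgeom] using
    affineIter_mul_of_periodic e (w := fun _ => (1 : ℤ)) (e := a) (fun _ => rfl) b

lemma dvd_geom_sum {p : ℕ} {e : ℤ} (h : (p : ℤ) ∣ e - 1) :
    (p : ℤ) ∣ ∑ t ∈ Finset.range p, e ^ t := by
  have : ∑ t ∈ Finset.range p, e ^ t = ∑ t ∈ Finset.range p, (e ^ t - 1) + p := by simp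
  rw [this]
  exact dvd_add (Finset.dvd_sum fun t _ => dvd_pow_sub_one h t) dvd_rfl

lemma pow_dvd_geom_sum {p : ℕ} {e : ℤ} (h : (p : ℤ) ∣ e - 1) (r : ℕ) :
    (p : ℤ) ^ r ∣ ∑ t ∈ Finset.range (p ^ r), e ^ t := by
  induction r with
  | zero => simp
  | succ r ih =>
    rw [pow_succ p r, geom_sum_mul_index, pow_succ']
    exact mul_dvd_mul (dvd_geom_sum (dvd_pow_sub_one h _)) ih

/-- Splitting off the first factor 2 of the length leaves (1 + d) times a sum of 2^j powers of d²;
the factor 1 + d contributes 2^v. -/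
lemma two_pow_dvd_geom_sum {d : ℤ} {v j : ℕ} (hd : (2 : ℤ) ∣ d - 1) (hv : (2 : ℤ) ^ v ∣ d + 1) :
    (2 : ℤ) ^ (j + v) ∣ ∑ t ∈ Finset.range (2 ^ (j + 1)), d ^ t := by
  rw [pow_succ', geom_sum_mul_index, pow_add]
  refine mul_dvd_mul ?_ ?_
  · exact_mod_cast pow_dvd_geom_sum (p := 2) (by exact_mod_cast dvd_pow_sub_one hd 2) j
  · simpa [Finset.sum_range_succ, add_comm] using hv

lemma mem_unitsU_iff {p i : ℕ} {d : ℤ} : d ∈ unitsU p i ↔ (p : ℤ) ^ i ∣ d - 1 := by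
  constructor
  · rintro ⟨x, rfl⟩
    exact ⟨x, by ring⟩
  · rintro ⟨x, hx⟩
    exact ⟨x, by linarith⟩

lemma neg_mem_unitsU_iff {p i : ℕ} {d : ℤ} : -d ∈ unitsU p i ↔ (p : ℤ) ^ i ∣ d + 1 := by
  rw [mem_unitsU_iff, ← dvd_neg]
  ring_nf

/-- Here d ≡ -1 mod 4, so `two_pow_dvd_geom_sum` applies with some v ≥ 2. If 2^i divides d + 1 (for
instance d = -1), v = i suffices; otherwise v is the exact valuation of d + 1, and condition (V)
gives i ≤ j + v for k = j + 1. -/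
lemma Admissible.two_pow_dvd_geom_sum {n m : ℕ} {a : Fin m → WithBot ℕ} {d : ℤ}
    (h : Admissible 2 n m a d) {z i : Fin m} (hz : (z : ℕ) = 0) (hex : IsExceptional 2 a d z)
    {k : ℕ} (hi : a i = k) (hzi : z < i) :
    (2 : ℤ) ^ (i : ℕ) ∣ ∑ t ∈ Finset.range (2 ^ k), d ^ t := by
  have hd : (2 : ℤ) ∣ d - 1 := by simpa using mem_unitsU_iff.mp h.mem_one
  have hi0 : 1 ≤ (i : ℕ) := by have : (z : ℕ) < i := hzi; omega
  have hk0 : k ≠ 0 := by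
    rintro rfl
    exact h.ne_zero z hex i hi0 (by simpa using hi)
  obtain ⟨j, rfl⟩ : ∃ j, k = j + 1 := ⟨k - 1, by omega⟩
  have h4 : (2 : ℤ) ^ 2 ∣ d + 1 := by
    have h4 : ¬ (2 : ℤ) ^ 2 ∣ d - 1 := fun h' => hex.2.1 (mem_unitsU_iff.mpr (by exact_mod_cast h'))
    norm_num at h4 ⊢
    omega
  have key : ∀ v, (2 : ℤ) ^ v ∣ d + 1 → (i : ℕ) ≤ j + v →
      (2 : ℤ) ^ (i : ℕ) ∣ ∑ t ∈ Finset.range (2 ^ (j + 1)), d ^ t := fun v hv hle =>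
    (pow_dvd_pow 2 hle).trans (_root_.two_pow_dvd_geom_sum hd hv)
  by_cases hall : (2 : ℤ) ^ (i : ℕ) ∣ d + 1
  · exact key i hall (by omega)
  · have hex' : ∃ w, ¬ (2 : ℤ) ^ w ∣ d + 1 := ⟨i, hall⟩
    classical
    obtain ⟨w, hw, hmin⟩ : ∃ w, ¬ (2 : ℤ) ^ w ∣ d + 1 ∧ ∀ u < w, (2 : ℤ) ^ u ∣ d + 1 :=
      ⟨Nat.find hex', Nat.find_spec hex', fun u hu => not_not.mp (Nat.find_min hex' hu)⟩
    have hw3 : 3 ≤ w := by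
      by_contra! hlt
      exact hw ((pow_dvd_pow 2 (by omega)).trans h4)
    obtain ⟨v, rfl⟩ : ∃ v, w = v + 1 := ⟨w - 1, by omega⟩
    refine key v (hmin v v.lt_succ_self) ?_
    have hvi : v ≤ i := by
      by_contra! hlt
      exact hall (hmin i (by omega))
    have := h.lt_of_neg rfl (by omega) (fun i' hi' => by
        rw [show i' = z from Fin.ext (by omega)]; exact hex.2.2.2) v (by omega)
      (neg_mem_unitsU_iff.mpr (by exact_mod_cast hmin v v.lt_succ_self))
      (fun h' => hw (by exact_mod_cast neg_mem_unitsU_iff.mp h')) i hvi (by simp [hi])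
    rw [hi] at this
    have : (i : ℕ) - (v - 1) < j + 1 := by exact_mod_cast this
    omega

/-- The divisibilities which make the holonomy of period `p ^ k` divisible by `p ^ i`
for `a i = k`. -/
lemma Admissible.dvd_geom_sum {p n m : ℕ} {a : Fin m → WithBot ℕ} {d : ℤ}
    (h : Admissible p n m a d) {i l : Fin m} {k e : ℕ} (hi : a i = k) (hl : a l = e)
    (hli : l < i) :
    e < k ∧ (p : ℤ) ^ ((i : ℕ) - l) ∣ ∑ s ∈ Finset.range (p ^ (k - e)), (d ^ p ^ e) ^ s := by
  have hlt : (l : ℕ) < i := hli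
  by_cases hex : IsExceptional p a d l
  · obtain ⟨rfl, -, hl0, hal⟩ := id hex
    have he : e = 0 := by rw [hl] at hal; exact_mod_cast hal
    subst he
    refine ⟨?_, ?_⟩
    · rw [Nat.pos_iff_ne_zero]
      rintro rfl
      exact h.ne_zero l hex i (by omega) (by simpa using hi)
    · simpa [hl0] using h.two_pow_dvd_geom_sum hl0 hex hi hli
  · have := h.add_lt l i (i - l) (by omega) (by omega) (by simp [hi]) hex
    rw [hi, hl] at this
    have : e + (i - l) < k := by exact_mod_cast this
    refine ⟨by omega, (pow_dvd_pow _ (by omega)).trans (pow_dvd_geom_sum (p := p)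
      (dvd_pow_sub_one ?_ _) (k - e))⟩
    simpa using mem_unitsU_iff.mp h.mem_one

end Arithmetic

/-! ### The holonomy map and its image -/

section Holonomy

variable (p : ℕ) {m : ℕ} (a : Fin m → WithBot ℕ) (d : ℤ) (j : ℕ)

/-- The obstruction to periodicity, with period `p ^ j`, of the solution of
`y (t + 1) = d * y t + ∑ i, p ^ i * x i t` with initial value `y₀`, where `x i` is periodic
of period `p ^ min (a i) j`. -/
def holonomy :
    ZMod (p ^ m) × (∀ i : Fin m, Fin (expBot p (min (a i) (j : WithBot ℕ))) → ZMod (p ^ m)) →+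
      ZMod (p ^ m) :=
  AddMonoidHom.mk' (fun v => affineIter (d : ZMod (p ^ m))
      (fun t => ∑ i : Fin m, (p : ZMod (p ^ m)) ^ (i : ℕ) * periodicExt (v.2 i) t) v.1 (p ^ j) - v.1)
    fun v v' => by
      have : (fun t => ∑ i : Fin m, (p : ZMod (p ^ m)) ^ (i : ℕ) * periodicExt ((v + v').2 i) t) =
          (fun t => ∑ i : Fin m, (p : ZMod (p ^ m)) ^ (i : ℕ) * periodicExt (v.2 i) t) +
          fun t => ∑ i : Fin m, (p : ZMod (p ^ m)) ^ (i : ℕ) * periodicExt (v'.2 i) t := by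
        funext t
        simp only [Prod.snd_add, Pi.add_apply, periodicExt_add, mul_add, Finset.sum_add_distrib]
      rw [this, Prod.fst_add, affineIter_add]
      ring

lemma holonomy_apply (y : ZMod (p ^ m)) (z) : holonomy p a d j (y, z) =
    affineIter (d : ZMod (p ^ m))
      (fun t => ∑ i : Fin m, (p : ZMod (p ^ m)) ^ (i : ℕ) * periodicExt (z i) t) y (p ^ j) - y := rfl

lemma holonomy_eq (y : ZMod (p ^ m)) (z) : holonomy p a d j (y, z) =
    ((d : ZMod (p ^ m)) ^ p ^ j - 1) * y + ∑ i : Fin m, (p : ZMod (p ^ m)) ^ (i : ℕ) *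
      affineIter (d : ZMod (p ^ m)) (periodicExt (z i)) 0 (p ^ j) := by
  rw [holonomy_apply, affineIter_eq_pow_mul_add, affineIter_sum_mul]
  ring

variable {p a d j}

/-- In `holonomy_eq` the term of y is controlled by `hd`, the terms l ≥ i carry p^l, and for l < i
the factor p^l is completed by p^(i - l) from the geometric sum over blocks of length p^e. -/
lemma pow_dvd_holonomy {i : ℕ} (hd : (p : ℤ) ^ i ∣ d ^ p ^ j - 1)
    (h : ∀ l : Fin m, (l : ℕ) < i → ∀ e : ℕ, a l = e → e < j ∧
      (p : ℤ) ^ (i - l) ∣ ∑ s ∈ Finset.range (p ^ (j - e)), (d ^ p ^ e) ^ s) (v) :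
    (p : ZMod (p ^ m)) ^ i ∣ holonomy p a d j v := by
  obtain ⟨y, z⟩ := v
  rw [holonomy_eq]
  refine dvd_add (Dvd.dvd.mul_right ?_ _) (Finset.dvd_sum fun l _ => ?_)
  · simpa using map_dvd (Int.castRingHom (ZMod (p ^ m))) hd
  rcases le_or_gt i (l : ℕ) with hli | hli
  · exact Dvd.dvd.mul_right (pow_dvd_pow _ hli) _
  generalize z l = x
  have hl := h l hli
  generalize a l = al at x hl
  induction al using WithBot.recBotCoe with
  | bot =>
    have : periodicExt x = fun _ => 0 := by
      funext t
      exact dif_neg (by simp)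
    rw [this, affineIter_zero, mul_zero]
    exact dvd_zero _
  | coe e =>
    obtain ⟨hej, hdvd⟩ := hl e rfl
    have hper : ∀ q, expBot p (min (WithBot.some e) (j : WithBot ℕ)) = q →
        Function.Periodic (periodicExt x) q := by
      rintro _ rfl
      exact periodicExt_periodic x
    replace hper := hper (p ^ e) (by rw [expBot_min_coe, min_eq_left hej.le])
    rw [show p ^ j = p ^ e * p ^ (j - e) by rw [← pow_add]; congr 1; omega,
      affineIter_mul_of_periodic _ hper, ← mul_assoc]
    refine Dvd.dvd.mul_right ?_ _
    rw [show i = l + (i - l) by omega, pow_add]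
    refine mul_dvd_mul dvd_rfl ?_
    simpa using map_dvd (Int.castRingHom (ZMod (p ^ m))) hdvd

lemma pow_mem_range_holonomy (hp : 0 < p) {i : Fin m} (hi : (j : WithBot ℕ) ≤ a i) :
    (p : ZMod (p ^ m)) ^ (i : ℕ) ∈ (holonomy p a d j).range := by
  have he : expBot p (min (a i) (j : WithBot ℕ)) = p ^ j := by rw [min_eq_right hi, expBot_coe]
  have hpos : 0 < expBot p (min (a i) (j : WithBot ℕ)) := by rw [he]; positivity
  refine ⟨(0, Pi.single i (Pi.single ⟨_ - 1, Nat.sub_lt hpos one_pos⟩ 1)), ?_⟩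
  rw [holonomy_eq, Finset.sum_eq_single i]
  · rw [Pi.single_eq_same, ← he, affineIter_periodicExt_single _ hpos]
    ring
  · intro l _ hl
    rw [Pi.single_eq_of_ne hl]
    have : periodicExt (0 : Fin (expBot p (min (a l) (j : WithBot ℕ))) → ZMod (p ^ m)) =
        fun _ => 0 := by
      funext t
      simp [periodicExt]
    rw [this, affineIter_zero, mul_zero]
  · simp

end Holonomy

/-! ### Orders of the image and kernel of the holonomy -/

section Card

variable {p m : ℕ}

lemma mem_zmultiples_iff_dvd {N : ℕ} {c x : ZMod N} : x ∈ AddSubgroup.zmultiples c ↔ c ∣ x := by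
  rw [AddSubgroup.mem_zmultiples_iff]
  constructor
  · rintro ⟨k, rfl⟩
    exact ⟨k, by rw [zsmul_eq_mul, mul_comm]⟩
  · rintro ⟨y, rfl⟩
    obtain ⟨k, rfl⟩ := ZMod.intCast_surjective y
    exact ⟨k, by rw [zsmul_eq_mul, mul_comm]⟩

lemma card_zmultiples_pow (hp : 0 < p) {i : ℕ} (hi : i ≤ m) :
    Nat.card (AddSubgroup.zmultiples ((p : ZMod (p ^ m)) ^ i)) = p ^ (m - i) := by
  rw [Nat.card_zmultiples, ← Nat.cast_pow, ZMod.addOrderOf_coe _ (pow_pos hp m).ne',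
    Nat.gcd_eq_right (pow_dvd_pow p hi), Nat.pow_div hi hp]

/-- H consists of the multiples of p^f; the bounds on f come from comparing orders with the
multiples of p^i. -/
lemma exists_card_addSubgroup (hp : p.Prime) (H : AddSubgroup (ZMod (p ^ m))) :
    ∃ f ≤ m, Nat.card H = p ^ (m - f) ∧
      (∀ i ≤ m, (∀ x ∈ H, (p : ZMod (p ^ m)) ^ i ∣ x) → i ≤ f) ∧
      ∀ i ≤ m, (p : ZMod (p ^ m)) ^ i ∈ H → f ≤ i := by
  have : NeZero (p ^ m) := ⟨(pow_pos hp.pos m).ne'⟩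
  have hdvd := AddSubgroup.card_addSubgroup_dvd_card H
  rw [Nat.card_zmod, Nat.dvd_prime_pow hp] at hdvd
  obtain ⟨k, hk, hcard⟩ := hdvd
  refine ⟨m - k, by omega, by rw [hcard, Nat.sub_sub_self hk], fun i hi h => ?_, fun i hi h => ?_⟩
  · have hle : H ≤ AddSubgroup.zmultiples ((p : ZMod (p ^ m)) ^ i) := fun x hx =>
      mem_zmultiples_iff_dvd.mpr (h x hx)
    have := Nat.card_mono (Set.toFinite _) hle
    change Nat.card H ≤ Nat.card (AddSubgroup.zmultiples ((p : ZMod (p ^ m)) ^ i)) at this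
    rw [hcard, card_zmultiples_pow hp.pos hi, Nat.pow_le_pow_iff_right hp.one_lt] at this
    omega
  · have hle := AddSubgroup.zmultiples_le_of_mem h
    have := Nat.card_mono (Set.toFinite _) hle
    change Nat.card (AddSubgroup.zmultiples ((p : ZMod (p ^ m)) ^ i)) ≤ Nat.card H at this
    rw [hcard, card_zmultiples_pow hp.pos hi, Nat.pow_le_pow_iff_right hp.one_lt] at this
    omega

lemma card_ker_holonomy_mul (a : Fin m → WithBot ℕ) (d : ℤ) (j : ℕ) :
    Nat.card (holonomy p a d j).ker * Nat.card (holonomy p a d j).range =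
      p ^ m * p ^ (m * truncSum p a j) := by
  rw [← AddSubgroup.index_ker, AddSubgroup.card_mul_index, Nat.card_prod, Nat.card_pi,
    Nat.card_zmod, truncSum, Finset.mul_sum, ← Finset.prod_pow_eq_pow_sum]
  congr 1
  refine Finset.prod_congr rfl fun i _ => ?_
  rw [Nat.card_fun, Nat.card_zmod, Nat.card_fin, pow_mul]

theorem Admissible.exists_isCorank {n : ℕ} (hp : p.Prime) (hm : 1 ≤ m)
    {a : Fin m → WithBot ℕ} {d : ℤ} (h : Admissible p n m a d) :
    ∃ f : ℕ → ℕ, IsCorank n a f ∧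
      ∀ j, Nat.card (holonomy p a d j).ker = p ^ (m * truncSum p a j + f j) := by
  choose f hfm hcard hle hge using fun j =>
    exists_card_addSubgroup hp (holonomy p a d j).range
  have hd1 : (p : ℤ) ∣ d - 1 := by simpa using mem_unitsU_iff.mp h.mem_one
  refine ⟨f, ⟨fun j _ => hfm j, fun j _ hj => ?_, fun j _ i hi => ?_, fun i k hik => ?_⟩,
    fun j => ?_⟩
  -- Only the term l = 0 has no factor p of its own; a_0 < j supplies one through its geometric sum.
  · refine hle j 1 hm ?_
    rintro _ ⟨v, rfl⟩
    refine pow_dvd_holonomy (by simpa using dvd_pow_sub_one hd1 _) (fun l hl e he => ?_) v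
    have hej : e < j := by
      have := hj l (by omega)
      rw [he] at this
      exact_mod_cast this
    exact ⟨hej, (pow_dvd_pow _ (by omega)).trans
      (pow_dvd_geom_sum (p := p) (dvd_pow_sub_one hd1 _) (j - e))⟩
  · exact hge j i i.isLt.le (pow_mem_range_holonomy hp.pos hi)
  · refine hle k i i.isLt.le ?_
    rintro _ ⟨v, rfl⟩
    refine pow_dvd_holonomy ?_ (fun l hl e he => h.dvd_geom_sum hik he hl) v
    have := mem_unitsU_iff.mp (h.pow_mem i)
    rw [hik, expBot_coe] at this
    exact (pow_dvd_pow _ (Nat.le_succ _)).trans this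
  · have hmul := card_ker_holonomy_mul (p := p) a d j
    rw [hcard j] at hmul
    refine Nat.eq_of_mul_eq_mul_right (pow_pos hp.pos (m - f j)) ?_
    rw [hmul, ← pow_add, ← pow_add]
    congr 1
    have := hfm j
    omega

end Card

/-! ### Group ring elements as periodic sequences -/

section Sequences

variable {R : Type*} [CommRing R] {G : Type*} [CommGroup G]

/-- The sequence of coefficients of `c` along the powers of `σ⁻¹`, on which multiplication
by `σ` is the shift. -/
noncomputable def coeffSeq (σ : G) (c : MonoidAlgebra R G) (t : ℕ) : R := c.coeff (σ ^ t)⁻¹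

lemma coeffSeq_of_pow_mul (σ : G) (k : ℕ) (c : MonoidAlgebra R G) (t : ℕ) :
    coeffSeq σ (MonoidAlgebra.of R G (σ ^ k) * c) t = coeffSeq σ c (t + k) := by
  rw [coeffSeq, coeffSeq, MonoidAlgebra.of_apply, MonoidAlgebra.coeff_single_mul_apply, one_mul,
    pow_add, mul_inv, mul_comm]

/-- `coeffSeq` as an additive map. -/
noncomputable def coeffSeqHom (R : Type*) [CommRing R] (σ : G) : MonoidAlgebra R G →+ (ℕ → R) :=
  AddMonoidHom.mk' (coeffSeq σ) fun _ _ => rfl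

lemma coeffSeqHom_apply (σ : G) (c : MonoidAlgebra R G) : coeffSeqHom R σ c = coeffSeq σ c := rfl

lemma coeffSeq_intCast_mul (σ : G) (d : ℤ) (c : MonoidAlgebra R G) (t : ℕ) :
    coeffSeq σ ((d : MonoidAlgebra R G) * c) t = (d : R) * coeffSeq σ c t := by
  rw [← zsmul_eq_mul, ← coeffSeqHom_apply, map_zsmul, Pi.smul_apply, zsmul_eq_mul,
    coeffSeqHom_apply]

lemma coeffSeq_sum_mul (σ : G) {m : ℕ} (p : ℕ) (x : Fin m → MonoidAlgebra R G) (t : ℕ) :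
    coeffSeq σ (∑ i : Fin m, (p : MonoidAlgebra R G) ^ (i : ℕ) * x i) t =
      ∑ i : Fin m, (p : R) ^ (i : ℕ) * coeffSeq σ (x i) t := by
  rw [← coeffSeqHom_apply, map_sum, Finset.sum_apply]
  refine Finset.sum_congr rfl fun i _ => ?_
  have := coeffSeq_intCast_mul σ ((p : ℤ) ^ (i : ℕ)) (x i) t
  push_cast at this
  rw [coeffSeqHom_apply, this]

lemma coeffSeq_injective [Finite G] {σ : G} (hσ : ∀ g : G, g ∈ Subgroup.zpowers σ) :
    Function.Injective (coeffSeq σ : MonoidAlgebra R G → ℕ → R) := by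
  intro c c' h
  ext g
  obtain ⟨t, ht⟩ := (mem_powers_iff_mem_zpowers (x := σ)).mpr (hσ g⁻¹)
  have := congrFun h t
  rwa [coeffSeq, coeffSeq, show σ ^ t = g⁻¹ from ht, inv_inv] at this

lemma exists_coeffSeq_eq [Finite G] {σ : G} (hσ : ∀ g : G, g ∈ Subgroup.zpowers σ) {s : ℕ → R}
    (hs : Function.Periodic s (Nat.card G)) : ∃ c : MonoidAlgebra R G, coeffSeq σ c = s := by
  have hpow : ∀ g : G, ∃ t : ℕ, σ ^ t = g⁻¹ := fun g =>
    (mem_powers_iff_mem_zpowers (x := σ)).mpr (hσ g⁻¹)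
  choose e he using hpow
  refine ⟨.ofCoeff (Finsupp.equivFunOnFinite.symm fun g => s (e g)), funext fun t => ?_⟩
  change s (e (σ ^ t)⁻¹) = s t
  have h := he (σ ^ t)⁻¹
  rw [inv_inv, pow_eq_pow_iff_modEq, orderOf_eq_card_of_forall_mem_zpowers hσ] at h
  rw [← hs.map_mod_nat, h, hs.map_mod_nat]

lemma of_pow_mul_eq_self_iff [Finite G] {σ : G} (hσ : ∀ g : G, g ∈ Subgroup.zpowers σ) {k : ℕ}
    {c : MonoidAlgebra R G} :
    MonoidAlgebra.of R G (σ ^ k) * c = c ↔ Function.Periodic (coeffSeq σ c) k := by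
  rw [← (coeffSeq_injective hσ).eq_iff, funext_iff]
  simp only [coeffSeq_of_pow_mul]
  rfl

end Sequences

/-! ### Universal property of X and the invariant homomorphisms -/

section Presentation

variable {p m : ℕ} {G : Type*} [CommGroup G] {σ : G} {a : Fin m → WithBot ℕ} {d : ℤ}

/-- The images of the free generators in `X_{a,d,m}`. -/
noncomputable def genMk (p : ℕ) (σ : G) (a : Fin m → WithBot ℕ) (d : ℤ) (o : Option (Fin m)) :
    ModuleX p m σ a d :=
  (relationsX p m σ a d).mkQ (Finsupp.single o 1)

lemma genMk_none_relation :
    (MonoidAlgebra.of (ZMod (p ^ m)) G σ - (d : GroupRing p m G)) • genMk p σ a d none =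
      ∑ i : Fin m, ((p : GroupRing p m G) ^ (i : ℕ)) • genMk p σ a d (some i) := by
  have h : _ ∈ relationsX p m σ a d := Submodule.subset_span (Set.mem_insert _ _)
  rw [← Submodule.Quotient.mk_eq_zero, ← Submodule.mkQ_apply, map_sub, map_smul, map_sum,
    sub_eq_zero] at h
  simp only [map_smul] at h
  exact h

lemma genMk_some_relation (i : Fin m) :
    sigmaPow p m σ (a i) • genMk p σ a d (some i) = genMk p σ a d (some i) := by
  have h : sigmaPow p m σ (a i) • genX p m G i - genX p m G i ∈ relationsX p m σ a d :=
    Submodule.subset_span (Set.mem_insert_of_mem _ ⟨i, rfl⟩)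
  rwa [← Submodule.Quotient.mk_eq_zero, ← Submodule.mkQ_apply, map_sub, map_smul,
    sub_eq_zero] at h

lemma moduleX_hom_ext {N : Type*} [AddCommGroup N] [Module (GroupRing p m G) N]
    {φ ψ : ModuleX p m σ a d →ₗ[GroupRing p m G] N}
    (h : ∀ o, φ (genMk p σ a d o) = ψ (genMk p σ a d o)) : φ = ψ := by
  refine Submodule.linearMap_qext _ (Finsupp.lhom_ext' fun o => LinearMap.ext_ring ?_)
  exact h o

lemma exists_moduleX_hom {N : Type*} [AddCommGroup N] [Module (GroupRing p m G) N]
    (v : Option (Fin m) → N)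
    (hy : (MonoidAlgebra.of (ZMod (p ^ m)) G σ - (d : GroupRing p m G)) • v none =
      ∑ i : Fin m, ((p : GroupRing p m G) ^ (i : ℕ)) • v (some i))
    (hx : ∀ i, sigmaPow p m σ (a i) • v (some i) = v (some i)) :
    ∃ φ : ModuleX p m σ a d →ₗ[GroupRing p m G] N, ∀ o, φ (genMk p σ a d o) = v o := by
  set f := Finsupp.linearCombination (GroupRing p m G) v with hf
  have hfs : ∀ o, f (Finsupp.single o 1) = v o := fun o => by
    rw [hf, Finsupp.linearCombination_single, one_smul]
  have hle : relationsX p m σ a d ≤ LinearMap.ker f := by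
    refine Submodule.span_le.mpr ?_
    rintro _ (rfl | ⟨i, rfl⟩)
    · simp only [SetLike.mem_coe, LinearMap.mem_ker, map_sub, map_smul, map_sum, genY, genX, hfs]
      rw [hy, sub_self]
    · simp only [SetLike.mem_coe, LinearMap.mem_ker, map_sub, map_smul, genX, hfs]
      rw [hx, sub_self]
  exact ⟨(relationsX p m σ a d).liftQ f hle, hfs⟩

/-- The homomorphisms to the group ring with values in the invariants of `σ ^ (p ^ j)`. -/
abbrev InvariantHom (p m : ℕ) (σ : G) (j : ℕ) (M : Type*) [AddCommGroup M]
    [Module (GroupRing p m G) M] : Type _ :=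
  {φ : M →ₗ[GroupRing p m G] GroupRing p m G //
    ∀ x, MonoidAlgebra.of (ZMod (p ^ m)) G (σ ^ p ^ j) * φ x = φ x}

lemma card_invariantHom_congr (j : ℕ) {M N : Type*} [AddCommGroup M]
    [Module (GroupRing p m G) M] [AddCommGroup N] [Module (GroupRing p m G) N]
    (e : M ≃ₗ[GroupRing p m G] N) :
    Nat.card (InvariantHom p m σ j M) = Nat.card (InvariantHom p m σ j N) :=
  Nat.card_congr
    { toFun := fun φ => ⟨φ.1 ∘ₗ e.symm.toLinearMap, fun x => φ.2 _⟩
      invFun := fun φ => ⟨φ.1 ∘ₗ e.toLinearMap, fun x => φ.2 _⟩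
      left_inv := fun φ => by ext1; ext1 x; simp
      right_inv := fun φ => by ext1; ext1 x; simp }

lemma of_mul_apply_eq_of_genMk {j : ℕ} {φ : ModuleX p m σ a d →ₗ[GroupRing p m G] GroupRing p m G}
    (h : ∀ o, MonoidAlgebra.of (ZMod (p ^ m)) G (σ ^ p ^ j) * φ (genMk p σ a d o) =
      φ (genMk p σ a d o)) (x) :
    MonoidAlgebra.of (ZMod (p ^ m)) G (σ ^ p ^ j) * φ x = φ x := by
  have : MonoidAlgebra.of (ZMod (p ^ m)) G (σ ^ p ^ j) • φ = φ := moduleX_hom_ext h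
  exact LinearMap.congr_fun this x

end Presentation

/-! ### Invariant homomorphisms as the kernel of the holonomy -/

section Count

variable {p m n : ℕ} {G : Type*} [CommGroup G] {σ : G} {a : Fin m → WithBot ℕ} {d : ℤ} {j : ℕ}

lemma periodicExt_periodic_pow {R : Type*} [CommRing R] {e : WithBot ℕ}
    (z : Fin (expBot p (min e (j : WithBot ℕ))) → R) : Function.Periodic (periodicExt z) (p ^ j) := by
  induction e using WithBot.recBotCoe with
  | bot =>
    have h : ∀ t, periodicExt z t = 0 := fun t => dif_neg (by simp)
    intro t
    rw [h, h]
  | coe k =>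
    have he := expBot_min_coe p k j
    generalize expBot p (min (WithBot.some k) (j : WithBot ℕ)) = e at he z
    subst he
    rw [show p ^ j = p ^ (j - min k j) * p ^ min k j by rw [← pow_add]; congr 1; omega]
    exact_mod_cast (periodicExt_periodic z).nat_mul _

/-- Powers of p are nested under divisibility, so periods p^j and p^k together amount to period
p^min(k, j). For -∞ the initial segment is empty and its extension is 0, matching the relation 0 =
c. -/
lemma sigmaPow_mul_eq_self_iff [Finite G] (hσ : ∀ g : G, g ∈ Subgroup.zpowers σ)
    {e : WithBot ℕ} {c : GroupRing p m G}
    (hc : Function.Periodic (coeffSeq σ c) (p ^ j)) (hp : 0 < p) :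
    sigmaPow p m σ e * c = c ↔
      periodicExt (fun t : Fin (expBot p (min e (j : WithBot ℕ))) => coeffSeq σ c t) =
        coeffSeq σ c := by
  induction e using WithBot.recBotCoe with
  | bot =>
    have h0 : periodicExt (fun t : Fin (expBot p (min ⊥ (j : WithBot ℕ))) => coeffSeq σ c t) =
        coeffSeq σ 0 := by
      funext t
      exact dif_neg (by simp)
    rw [h0, (coeffSeq_injective hσ).eq_iff, show sigmaPow p m σ ⊥ = 0 from rfl, zero_mul]
  | coe k =>
    change MonoidAlgebra.of _ G (σ ^ p ^ k) * c = c ↔ _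
    rw [of_pow_mul_eq_self_iff hσ]
    have he := expBot_min_coe p k j
    generalize expBot p (min (WithBot.some k) (j : WithBot ℕ)) = e at he ⊢
    subst he
    constructor
    · intro hk
      refine periodicExt_eq (pow_pos hp _) ?_
      rcases le_total k j with h | h
      · rwa [min_eq_left h]
      · rwa [min_eq_right h]
    · intro h
      have hper := periodicExt_periodic
        (fun t : Fin (p ^ min k j) => coeffSeq σ c t)
      rw [h] at hper
      rw [show p ^ k = p ^ (k - min k j) * p ^ min k j by rw [← pow_add]; congr 1; omega]
      exact_mod_cast hper.nat_mul _

lemma sub_mul_eq_sum_iff [Finite G] (hσ : ∀ g : G, g ∈ Subgroup.zpowers σ)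
    {y : GroupRing p m G} {x : Fin m → GroupRing p m G} :
    (MonoidAlgebra.of (ZMod (p ^ m)) G σ - (d : GroupRing p m G)) * y =
        ∑ i : Fin m, ((p : GroupRing p m G) ^ (i : ℕ)) * x i ↔
      ∀ t, coeffSeq σ y (t + 1) = (d : ZMod (p ^ m)) * coeffSeq σ y t +
        ∑ i : Fin m, (p : ZMod (p ^ m)) ^ (i : ℕ) * coeffSeq σ (x i) t := by
  rw [sub_mul, sub_eq_iff_eq_add', ← (coeffSeq_injective hσ).eq_iff, funext_iff]
  refine forall_congr' fun t => ?_
  have h1 := coeffSeq_of_pow_mul σ 1 y t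
  rw [pow_one] at h1
  rw [h1, ← coeffSeqHom_apply σ (_ + _), map_add, Pi.add_apply, coeffSeqHom_apply,
    coeffSeqHom_apply, coeffSeq_intCast_mul, coeffSeq_sum_mul]

/-- The initial value and the initial segments of the sequences of a homomorphism. -/
noncomputable def initialData (σ : G) (a : Fin m → WithBot ℕ) (d : ℤ) (j : ℕ)
    (φ : ModuleX p m σ a d →ₗ[GroupRing p m G] GroupRing p m G) :
    ZMod (p ^ m) × (∀ i : Fin m, Fin (expBot p (min (a i) (j : WithBot ℕ))) → ZMod (p ^ m)) :=
  (coeffSeq σ (φ (genMk p σ a d none)) 0,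
    fun i t => coeffSeq σ (φ (genMk p σ a d (some i))) t)

lemma InvariantHom.periodicExt_initialData [Finite G] (hσ : ∀ g : G, g ∈ Subgroup.zpowers σ)
    (hp : 0 < p) (φ : InvariantHom p m σ j (ModuleX p m σ a d)) (i : Fin m) :
    periodicExt ((initialData σ a d j φ.1).2 i) = coeffSeq σ (φ.1 (genMk p σ a d (some i))) := by
  refine (sigmaPow_mul_eq_self_iff hσ ((of_pow_mul_eq_self_iff hσ).mp (φ.2 _)) hp).mp ?_
  rw [← smul_eq_mul, ← map_smul, genMk_some_relation]

lemma InvariantHom.coeffSeq_none [Finite G] (hσ : ∀ g : G, g ∈ Subgroup.zpowers σ)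
    (hp : 0 < p) (φ : InvariantHom p m σ j (ModuleX p m σ a d)) (t : ℕ) :
    coeffSeq σ (φ.1 (genMk p σ a d none)) t = affineIter (d : ZMod (p ^ m))
      (fun t => ∑ i : Fin m, (p : ZMod (p ^ m)) ^ (i : ℕ) *
        periodicExt ((initialData σ a d j φ.1).2 i) t) (initialData σ a d j φ.1).1 t := by
  refine eq_affineIter (fun t => ?_) t
  simp only [φ.periodicExt_initialData hσ hp]
  refine (sub_mul_eq_sum_iff hσ
    (x := fun i => φ.1 (genMk p σ a d (some i)))).mp ?_ t
  simp only [← smul_eq_mul, ← map_smul, ← map_sum]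
  rw [genMk_none_relation]

/-- The relations reconstruct a homomorphism from its initial data, and return of y after p^j steps
is the kernel condition. Conversely p^j divides |G|, so the sequences of a kernel element come from
group ring elements satisfying the relations. -/
theorem card_invariantHom_moduleX [Finite G] (hσ : ∀ g : G, g ∈ Subgroup.zpowers σ)
    (hG : Nat.card G = p ^ n) (hp : 0 < p) (hj : j ≤ n) :
    Nat.card (InvariantHom p m σ j (ModuleX p m σ a d)) = Nat.card (holonomy p a d j).ker := by
  have hper : ∀ {s : ℕ → ZMod (p ^ m)}, Function.Periodic s (p ^ j) →
      Function.Periodic s (Nat.card G) := fun {s} hs => by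
    rw [hG, show p ^ n = p ^ (n - j) * p ^ j by rw [← pow_add]; congr 1; omega]
    exact_mod_cast hs.nat_mul _
  refine Nat.card_eq_of_bijective
    (fun φ => (⟨initialData σ a d j φ.1, ?_⟩ : (holonomy p a d j).ker)) ⟨?_, ?_⟩
  · have h := (of_pow_mul_eq_self_iff hσ).mp (φ.2 (genMk p σ a d none)) 0
    rw [AddMonoidHom.mem_ker]
    refine sub_eq_zero.mpr ?_
    rw [← φ.coeffSeq_none hσ hp]
    rwa [zero_add] at h
  · intro φ ψ h
    have h' : initialData σ a d j φ.1 = initialData σ a d j ψ.1 := congrArg Subtype.val h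
    refine Subtype.ext (moduleX_hom_ext fun o => coeffSeq_injective hσ ?_)
    cases o with
    | none =>
      funext t
      rw [φ.coeffSeq_none hσ hp, ψ.coeffSeq_none hσ hp, h']
    | some i => rw [← φ.periodicExt_initialData hσ hp, ← ψ.periodicExt_initialData hσ hp, h']
  · rintro ⟨⟨y₀, z⟩, hz⟩
    rw [AddMonoidHom.mem_ker, holonomy_apply, sub_eq_zero] at hz
    have hzper : ∀ i, Function.Periodic (periodicExt (z i)) (p ^ j) := fun i =>
      periodicExt_periodic_pow (z i)
    obtain ⟨y, hy⟩ := exists_coeffSeq_eq hσ (hper (affineIter_periodic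
      (fun t => Finset.sum_congr rfl fun i _ => by rw [hzper i t]) hz))
    choose x hx using fun i => exists_coeffSeq_eq hσ (hper (hzper i))
    obtain ⟨φ, hφ⟩ := exists_moduleX_hom (p := p) (N := GroupRing p m G) (σ := σ) (a := a) (d := d)
      (fun o => o.elim y x) (by
        simp only [smul_eq_mul]
        refine (sub_mul_eq_sum_iff hσ).mpr fun t => ?_
        simp only [Option.elim, hy, hx]
        rfl) (fun i => by
        rw [smul_eq_mul]
        refine (sigmaPow_mul_eq_self_iff hσ (j := j) ?_ hp).mpr ?_
        · simp only [Option.elim, hx]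
          exact hzper i
        · simp only [Option.elim, hx, periodicExt_apply_fin])
    refine ⟨⟨φ, of_mul_apply_eq_of_genMk fun o => (of_pow_mul_eq_self_iff hσ).mpr ?_⟩,
      Subtype.ext (Prod.ext ?_ ?_)⟩
    · rw [hφ]
      cases o with
      | none =>
        simp only [Option.elim, hy]
        exact affineIter_periodic
          (fun t => Finset.sum_congr rfl fun i _ => by rw [hzper i t]) hz
      | some i =>
        simp only [Option.elim, hx]
        exact hzper i
    · simp only [initialData, hφ, Option.elim, hy]
      rfl
    · funext i t
      simp only [initialData, hφ, Option.elim, hx, periodicExt_apply_fin]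

end Count

/-! ### The invariant Φ -/

/-- The number of homomorphisms from `X_{a,d,m}` to the invariants of `σ ^ (p ^ j)` in the group
ring, for `0 ≤ j ≤ n`, determines `a`. -/
theorem Admissible.eq_of_card_invariantHom {p n m : ℕ} (hp : p.Prime) (hn : 1 ≤ n) (hm : 1 ≤ m)
    {G : Type*} [CommGroup G] (hG : Nat.card G = p ^ n)
    {σ : G} (hσ : ∀ g : G, g ∈ Subgroup.zpowers σ) {a a' : Fin m → WithBot ℕ} {d d' : ℤ}
    (h : Admissible p n m a d) (h' : Admissible p n m a' d')
    (hcard : ∀ j ≤ n, Nat.card (InvariantHom p m σ j (ModuleX p m σ a d)) =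
      Nat.card (InvariantHom p m σ j (ModuleX p m σ a' d'))) : a = a' := by
  have : Finite G := Nat.finite_of_card_ne_zero (by rw [hG]; exact (pow_pos hp.pos n).ne')
  obtain ⟨f, hf, hfcard⟩ := h.exists_isCorank hp hm
  obtain ⟨f', hf', hfcard'⟩ := h'.exists_isCorank hp hm
  refine h.eq_of_isCorank hp hn hm h' hf hf' fun j hj => Nat.pow_right_injective hp.two_le ?_
  simp only
  rw [← hfcard, ← hfcard', ← card_invariantHom_moduleX hσ hG hp.pos hj,
    ← card_invariantHom_moduleX hσ hG hp.pos hj]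
  exact hcard j hj

theorem proposition5p1 (p n m : ℕ) (hp : p.Prime) (hn : 1 ≤ n) (hm : 1 ≤ m)
    (G : Type u) [CommGroup G] (hG : Nat.card G = p ^ n)
    (σ : G) (hσ : ∀ g : G, g ∈ Subgroup.zpowers σ) :
    (∃ Φ : ModuleCat.{u} (GroupRing p m G) → (Fin m → WithBot ℕ),
      (∀ M N : ModuleCat.{u} (GroupRing p m G),
        Nonempty (M ≃ₗ[GroupRing p m G] N) → Φ M = Φ N) ∧
      ∀ (a : Fin m → WithBot ℕ) (d : ℤ), Admissible p n m a d →
        Φ (ModuleCat.of (GroupRing p m G) (ModuleX p m σ a d)) = a) ∧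
    (∀ (a a' : Fin m → WithBot ℕ) (d d' : ℤ),
      Admissible p n m a d → Admissible p n m a' d' → a ≠ a' →
        IsEmpty (ModuleX p m σ a d ≃ₗ[GroupRing p m G] ModuleX p m σ a' d')) := by
  -- P depends on M only through cardinalities, so isomorphic modules yield the same predicate and
  -- the same choice by `epsilon`. For X_{a,d,m} every vector satisfying P is `a`, whichever d
  -- witnesses it.
  let P : ModuleCat.{u} (GroupRing p m G) → (Fin m → WithBot ℕ) → Prop := fun M a =>
    ∃ d, Admissible p n m a d ∧ ∀ j ≤ n, Nat.card (InvariantHom p m σ j M) =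
      Nat.card (InvariantHom p m σ j (ModuleX p m σ a d))
  refine ⟨⟨fun M => Classical.epsilon (P M), ?_, ?_⟩, ?_⟩
  · rintro M N ⟨e⟩
    have hP : P M = P N := by
      funext a
      simp only [P, fun j => card_invariantHom_congr (σ := σ) j e]
    simp only [hP]
  · intro a d h
    obtain ⟨d', h', hcard⟩ := Classical.epsilon_spec
      (p := P (ModuleCat.of (GroupRing p m G) (ModuleX p m σ a d))) ⟨a, d, h, fun _ _ => rfl⟩
    exact (h.eq_of_card_invariantHom hp hn hm hG hσ h' hcard).symm
  · intro a a' d d' h h' hne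
    exact ⟨fun e => hne (h.eq_of_card_invariantHom hp hn hm hG hσ h' fun j _ =>
      card_invariantHom_congr j e)⟩
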